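/- Fix an infinite set $\mathcal{A}$ of visible actions and an invisible action $\tau \notin \mathcal{A}$. A \emph{labelled transition system} (LTS) is a tuple $L = (S, \Sigma, \Delta, \hat s)$ with a set of states $S$, an alphabet $\Sigma \subseteq \mathcal{A}$, a transition relation $\Delta \subseteq S \times (\Sigma \cup \{\tau\}) \times S$ and an initial state $\hat s \in S$; $S$ and $\Sigma$ may be infinite. We write $\Sigma(L)$ for the alphabet of $L$. \textbf{Operators.} (i) Action prefix $a.L$ ($a \ne \tau$): a new initial state $\hat s'$ and the transition $(\hat s', a, \hat s)$ are added to $L$, and the alphabet becomes $\Sigma \cup \{a\}$. (ii) Hiding $L \setminus A$ ($A$ a set of actions): the labels in $A$ are replaced by $\tau$, and the alphabet becomes $\Sigma \setminus A$. (iii) Relational renaming $L\Phi$ ($\Phi$ a set of pairs of visible actions): write $\Phi(a,b)$ if $(a,b) \in \Phi$, or if $a = b$ and $a$ is not the first component of any pair in $\Phi$; the transitions of $L\Phi$ are all $(s,b,s')$ such that $(s,a,s') \in \Delta$ and $\Phi(a,b)$ for some $a$ (so $\tau$-transitions are unchanged), and its alphabet is $\{ b \mid \exists a \in \Sigma : \Phi(a,b)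 \}$. (iv) Parallel composition $L_1 \,||\, L_2$: the state set is $S_1 \times S_2$, the initial state is $(\hat s_1, \hat s_2)$, the alphabet is $\Sigma_1 \cup \Sigma_2$; actions in $\Sigma_1 \cap \Sigma_2$ are executed jointly by both components, and $\tau$ and all other actions are executed by one component while the other one stays in its state. A \emph{congruence} is an equivalence relation $\cong$ on LTSs such that $L \cong L'$ implies $a.L \cong a.L'$, $L \setminus A \cong L' \setminus A$, $L\Phi \cong L'\Phi$, $L \,||\, L'' \cong L' \,||\, L''$ and $L'' \,||\, L \cong L'' \,||\, L'$ for all $a$, $A$, $\Phi$ and $L''$. \textbf{Semantic sets.} For $\sigma \in \Sigma^*$ write $s \stackrel{\sigma}{\Rightarrow} s'$ if some finite path leads from $s$ to $s'$ whose sequence of non-$\tau$ labels is $\sigma$. For $\xi \in \Sigma^\omega$ write $s \stackrel{\xi}{\Rightarrow}$ if some infinite path starts at $s$ whose sequence of non-$\tau$ labels is $\xi$. Write $s \stackrel{\tau^\omega}{\to}$ if an infinite path consisting of $\tau$-transitions only starts at $s$. Let \begin{align*} \mathit{Sf}(L) &= \{ (\sigma, A) \in \Sigma^* \times 2^\Sigma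 \mid \exists s : \hat s \stackrel{\sigma}{\Rightarrow} s \wedge \forall a \in A \cup \{\tau\}\ \forall s' : (s,a,s') \notin \Delta \},\\ \mathit{Div}(L) &= \{ \sigma \in \Sigma^* \mid \exists s : \hat s \stackrel{\sigma}{\Rightarrow} s \wedge s \stackrel{\tau^\omega}{\to} \},\\ \mathit{Inf}(L) &= \{ \xi \in \Sigma^\omega \mid \hat s \stackrel{\xi}{\Rightarrow} \},\\ \mathit{aenI}(L) &= \{ a_1 a_2 \cdots \in \mathit{Inf}(L) \mid \forall n \ge 0\ \exists i \ge n : a_1 \cdots a_i \notin \mathit{Div}(L) \}. \end{align*} \emph{CFFD-equivalence} $L \doteq L'$ means $\Sigma(L) = \Sigma(L')$, $\mathit{Sf}(L) = \mathit{Sf}(L')$, $\mathit{Div}(L) = \mathit{Div}(L')$ and $\mathit{Inf}(L) = \mathit{Inf}(L')$. A relation $\cong$ \emph{preserves} $X$ if $L \cong L'$ implies $X(L) = X(L')$ for all $L$ and $L'$. \textbf{Theorem.} Let $\cong$ be a congruence such that $L \doteq L'$ implies $L \cong L'$ for all LTSs $L$ and $L'$. Assume that $\cong$ preserves $\mathit{Sf}$,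 $\mathit{Div}$ and $\mathit{aenI}$ but does not preserve $\mathit{Inf}$. Then, for all LTSs $L$ and $L'$, $$L \cong L' \iff \Sigma(L) = \Sigma(L'),\ \mathit{Sf}(L) = \mathit{Sf}(L'),\ \mathit{Div}(L) = \mathit{Div}(L') \text{ and } \mathit{aenI}(L) = \mathit{aenI}(L').$$ -/

import Mathlib

universe u v

/-- A labelled transition system whose visible actions are taken from `Act`. Labels are elements of
`Option Act`: `none` is the invisible action `τ` and `some a` is the visible action `a`, so that
`τ` belongs to no alphabet. The alphabet is an arbitrary set of visible actions. -/
structure LTS (Act : Type u) where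
  State : Type v
  alph : Set Act
  trans : State → Option Act → State → Prop
  init : State
  trans_mem : ∀ s a s', trans s (some a) s' → a ∈ alph

namespace LTS

variable {Act : Type u}

/-! ### The operators -/

/-- The transitions of `a.L`; the state `none` is the new initial state. -/
inductive PrefixingTrans (a : Act) (L : LTS.{u, v} Act) :
    Option L.State → Option Act → Option L.State → Prop
  | start : PrefixingTrans a L none (some a) (some L.init)
  | step (s : L.State) (x : Option Act) (s' : L.State) :
      L.trans s x s' → PrefixingTrans a L (some s) x (some s')

/-- Action prefix `a.L`. -/
def prefixing (a : Act) (L : LTS.{u, v} Act) : LTS.{u, v} Act where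
  State := Option L.State
  alph := L.alph ∪ {a}
  trans := PrefixingTrans a L
  init := none
  trans_mem := by
    intro s b s' h
    cases h with
    | start => exact Or.inr rfl
    | step s _ s' h => exact Or.inl (L.trans_mem _ _ _ h)

/-- Hiding `L \ A`. -/
def hide (L : LTS.{u, v} Act) (A : Set Act) : LTS.{u, v} Act where
  State := L.State
  alph := L.alph \ A
  trans s x s' := ∃ y, L.trans s y s' ∧ ((x = y ∧ y ∉ some '' A) ∨ (x = none ∧ y ∈ some '' A))
  init := L.init
  trans_mem := by
    rintro s a s' ⟨y, hy, ⟨rfl, hA⟩ | ⟨h, _⟩⟩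
    · exact ⟨L.trans_mem _ _ _ hy, fun ha => hA ⟨a, ha, rfl⟩⟩
    · cases h

/-- `Φ(a, b)`: the pair `(a, b)` is in `Φ`, or `a = b` is not in the domain of `Φ`. -/
def Renames (Φ : Set (Act × Act)) (a b : Act) : Prop :=
  (a, b) ∈ Φ ∨ (a = b ∧ ¬ ∃ c, (a, c) ∈ Φ)

/-- `Renames` on labels. Neither the domain nor the range of `Φ` contains `τ`, so `τ` is renamed
to `τ` only, and no visible action is renamed to `τ`. -/
def RenamesLabel (Φ : Set (Act × Act)) : Option Act → Option Act → Prop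
  | none, none => True
  | some a, some b => Renames Φ a b
  | _, _ => False

/-- Relational renaming `LΦ`. -/
def rename (L : LTS.{u, v} Act) (Φ : Set (Act × Act)) : LTS.{u, v} Act where
  State := L.State
  alph := {b | ∃ a ∈ L.alph, Renames Φ a b}
  trans s y s' := ∃ x, L.trans s x s' ∧ RenamesLabel Φ x y
  init := L.init
  trans_mem := by
    rintro s b s' ⟨_ | a, hx, h⟩
    · exact h.elim
    · exact ⟨a, L.trans_mem _ _ _ hx, h⟩

/-- Parallel composition `L₁ || L₂`: common visible actions are executed jointly, `τ` and all
other actions are executed by one component. -/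
def par (L₁ L₂ : LTS.{u, v} Act) : LTS.{u, v} Act where
  State := L₁.State × L₂.State
  alph := L₁.alph ∪ L₂.alph
  trans s x s' :=
    (x ∉ some '' L₂.alph ∧ L₁.trans s.1 x s'.1 ∧ s'.2 = s.2) ∨
    (x ∉ some '' L₁.alph ∧ L₂.trans s.2 x s'.2 ∧ s'.1 = s.1) ∨
    (x ∈ some '' (L₁.alph ∩ L₂.alph) ∧ L₁.trans s.1 x s'.1 ∧ L₂.trans s.2 x s'.2)
  init := (L₁.init, L₂.init)
  trans_mem := by
    rintro s a s' (⟨_, h, _⟩ | ⟨_, h, _⟩ | ⟨_, h, _⟩)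
    · exact Or.inl (L₁.trans_mem _ _ _ h)
    · exact Or.inr (L₂.trans_mem _ _ _ h)
    · exact Or.inl (L₁.trans_mem _ _ _ h)

/-! ### Abstract executions -/

/-- A finite, possibly empty, sequence of `τ`-transitions leads from `s` to `s'`. -/
def TauReach (L : LTS.{u, v} Act) (s s' : L.State) : Prop :=
  Relation.ReflTransGen (fun t t' => L.trans t none t') s s'

/-- Some path from `s` to `s'` has `σ` as its sequence of visible labels. -/
def Reach (L : LTS.{u, v} Act) : L.State → List Act → L.State → Prop
  | s, [], s' => L.TauReach s s'
  | s, a :: σ, s' => ∃ t t', L.TauReach s t ∧ L.trans t (some a) t' ∧ L.Reach t' σ s'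

/-- Some infinite path that starts at `s` has the infinite sequence `ξ` as its sequence of
visible labels. -/
def InfReach (L : LTS.{u, v} Act) (s : L.State) (ξ : ℕ → Act) : Prop :=
  ∃ p q : ℕ → L.State, p 0 = s ∧
    ∀ i, L.TauReach (p i) (q i) ∧ L.trans (q i) (some (ξ i)) (p (i + 1))

/-- An infinite sequence of `τ`-transitions starts at `s`. -/
def Diverges (L : LTS.{u, v} Act) (s : L.State) : Prop :=
  ∃ p : ℕ → L.State, p 0 = s ∧ ∀ i, L.trans (p i) none (p (i + 1))

/-! ### Semantic sets -/

/-- Stable failures. -/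
def Sf (L : LTS.{u, v} Act) : Set (List Act × Set Act) :=
  {f | f.2 ⊆ L.alph ∧ ∃ s, L.Reach L.init f.1 s ∧
    ∀ x ∈ some '' f.2 ∪ {none}, ∀ s', ¬ L.trans s x s'}

/-- Divergence traces. -/
def Div (L : LTS.{u, v} Act) : Set (List Act) :=
  {σ | ∃ s, L.Reach L.init σ s ∧ L.Diverges s}

/-- Infinite traces. -/
def Inf (L : LTS.{u, v} Act) : Set (ℕ → Act) :=
  {ξ | L.InfReach L.init ξ}

/-- Always-eventually-nondivergent infinite traces: infinitely many finite prefixes are not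
divergence traces. -/
def aenI (L : LTS.{u, v} Act) : Set (ℕ → Act) :=
  {ξ | ξ ∈ L.Inf ∧ ∀ n : ℕ, ∃ i, n ≤ i ∧ (List.range i).map ξ ∉ L.Div}

/-! ### Equivalences -/

/-- CFFD-equivalence, the equivalence induced by the alphabet, `Sf`, `Div` and `Inf`. -/
def CFFD (L L' : LTS.{u, v} Act) : Prop :=
  L.alph = L'.alph ∧ L.Sf = L'.Sf ∧ L.Div = L'.Div ∧ L.Inf = L'.Inf

/-- The equivalence induced by the alphabet, `Sf`, `Div` and `aenI`. -/
def SfDivAenIEquiv (L L' : LTS.{u, v} Act) : Prop :=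
  L.alph = L'.alph ∧ L.Sf = L'.Sf ∧ L.Div = L'.Div ∧ L.aenI = L'.aenI

/-- `r` is a congruence with respect to action prefix, hiding, relational renaming and parallel
composition. -/
structure IsCongruence (r : LTS.{u, v} Act → LTS.{u, v} Act → Prop) : Prop where
  equivalence : Equivalence r
  prefixing : ∀ (a : Act) (L L' : LTS.{u, v} Act), r L L' → r (L.prefixing a) (L'.prefixing a)
  hide : ∀ (A : Set Act) (L L' : LTS.{u, v} Act), r L L' → r (L.hide A) (L'.hide A)
  rename : ∀ (Φ : Set (Act × Act)) (L L' : LTS.{u, v} Act),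
    r L L' → r (L.rename Φ) (L'.rename Φ)
  par_right : ∀ L L' M : LTS.{u, v} Act, r L L' → r (L.par M) (L'.par M)
  par_left : ∀ L L' M : LTS.{u, v} Act, r L L' → r (M.par L) (M.par L')

/-- `r` preserves `X`: any two `r`-related LTSs have the same `X`. -/
def Preserves {α : Type*} (r : LTS.{u, v} Act → LTS.{u, v} Act → Prop)
    (X : LTS.{u, v} Act → α) : Prop :=
  ∀ L L', r L L' → X L = X L'

end LTS

/-!
Only the alphabet is missing from the forward direction. If `a` belonged to just one of two related
alphabets, hiding everything but `a` would give related LTSs with the alphabets `{a}` and `∅`. The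
former absorbs `|| loop a` up to CFFD-equivalence, hence so would the latter up to the congruence.
This is impossible, because `|| loop a` then adds the trace `a` to a stable failure or to a
divergence trace (`IsCongruence.alph_eq`).

For the converse, let `L₁` and `L₂` be related and let `ξ` be an infinite trace of `L₁` only. The
parallel composition with an LTS that just follows `ξ` gives related LTSs `Y` and `Y'` of which the
first has an infinite trace while the second has none (`inf_par_follow_nonempty_iff`).

For any `L` and `Y`, the LTS `ext L Y` behaves like `L` until it jumps, by some visible action, to a
copy of `Y` whose visible actions are replaced by arbitrary ones, subject to the trace staying in
`Div L`. The states after the jump diverge, so the jump adds nothing to `Sf` or `Div`, whatever `Y`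
is (`sf_ext`, `div_ext`). It adds no infinite traces if `Y` has none (`cffd_ext`), and otherwise
exactly the sequences almost all of whose prefixes are in `Div L` (`inf_ext`). Up to
CFFD-equivalence, `ext L Y` is obtained from `Y` by the operators (`cffd_ext_context`), so
`ext L Y` and `ext L Y'` are related. The context uses two disjoint copies of the actions, to tell
those before the jump, in which `Y` takes no part, from the others; an infinite set of actions has
room for both.

If `L` and `L'` agree on the alphabet, `Sf`, `Div` and `aenI`, then `ext L Y` and `ext L' Y` are
CFFD-equivalent, because `Inf ∪ evDiv = aenI ∪ evDiv`. Therefore `L`, `ext L Y'`, `ext L Y`,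
`ext L' Y`, `ext L' Y'` and `L'` are all related (`IsCongruence.of_sfDivAenIEquiv`).

The state spaces are built from those of `L` and `Y` alone (sets of states instead of traces, for
instance), since the universe of the states may be smaller than that of the actions.
-/

/-! ### Paths -/

namespace LTS

variable {Act : Type u}

theorem TauReach.map {L L' : LTS.{u, v} Act} {s s' : L.State} (h : L.TauReach s s')
    (f : L.State → L'.State) (hf : ∀ t t', L.trans t none t' → L'.trans (f t) none (f t')) :
    L'.TauReach (f s) (f s') := by
  induction h with
  | refl => exact Relation.ReflTransGen.refl
  | tail _ h ih => exact ih.tail (hf _ _ h)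

theorem TauReach.append_reach {L : LTS.{u, v} Act} {s t s' : L.State} {σ : List Act}
    (h : L.TauReach s t) (h' : L.Reach t σ s') : L.Reach s σ s' := by
  cases σ with
  | nil => exact Relation.ReflTransGen.trans h h'
  | cons a σ =>
    obtain ⟨u, u', h₁, h₂, h₃⟩ := h'
    exact ⟨u, u', Relation.ReflTransGen.trans h h₁, h₂, h₃⟩

theorem reach_append {L : LTS.{u, v} Act} {s s' : L.State} {σ ρ : List Act} :
    L.Reach s (σ ++ ρ) s' ↔ ∃ t, L.Reach s σ t ∧ L.Reach t ρ s' := by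
  induction σ generalizing s with
  | nil =>
    constructor
    · exact fun h => ⟨s, Relation.ReflTransGen.refl, h⟩
    · rintro ⟨t, h, h'⟩
      exact TauReach.append_reach h h'
  | cons a σ ih =>
    constructor
    · rintro ⟨u, u', h₁, h₂, h₃⟩
      obtain ⟨t, h₄, h₅⟩ := ih.1 h₃
      exact ⟨t, ⟨u, u', h₁, h₂, h₄⟩, h₅⟩
    · rintro ⟨t, ⟨u, u', h₁, h₂, h₄⟩, h₅⟩
      exact ⟨u, u', h₁, h₂, ih.2 ⟨t, h₄, h₅⟩⟩

theorem Reach.of_trans {L : LTS.{u, v} Act} {s s' : L.State} {a : Act}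
    (h : L.trans s (some a) s') : L.Reach s [a] s' :=
  ⟨s, s', Relation.ReflTransGen.refl, h, Relation.ReflTransGen.refl⟩

theorem Reach.trans_tauReach {L : LTS.{u, v} Act} {s t s' : L.State} {σ : List Act}
    (h : L.Reach s σ t) (h' : L.TauReach t s') : L.Reach s σ s' := by
  have := reach_append.2 ⟨t, h, show L.Reach t [] s' from h'⟩
  rwa [List.append_nil] at this

/-- Induction along finite executions: a property of states indexed by the trace performed so far
holds wherever an execution ends if it holds initially and every transition maintains it. -/
theorem Reach.invariant {L : LTS.{u, v} Act} {P : List Act → L.State → Prop}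
    (hτ : ∀ ρ s s', P ρ s → L.trans s none s' → P ρ s')
    (ha : ∀ ρ s a s', P ρ s → L.trans s (some a) s' → P (ρ ++ [a]) s')
    {ρ σ : List Act} {s s' : L.State} (h : L.Reach s σ s') (hP : P ρ s) : P (ρ ++ σ) s' := by
  have key : ∀ {ρ s s'}, L.TauReach s s' → P ρ s → P ρ s' := by
    intro ρ s s' h hP
    induction h with
    | refl => exact hP
    | tail _ h ih => exact hτ _ _ _ ih h
  induction σ generalizing ρ s with
  | nil => simpa using key h hP
  | cons a σ ih =>
    obtain ⟨t, t', h₁, h₂, h₃⟩ := h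
    simpa using ih h₃ (ha _ _ _ _ (key h₁ hP) h₂)

theorem map_range_succ (ξ : ℕ → Act) (n : ℕ) :
    (List.range (n + 1)).map ξ = (List.range n).map ξ ++ [ξ n] := by
  simp [List.range_succ]

theorem map_range_succ_eq_cons (ξ : ℕ → Act) (n : ℕ) :
    (List.range (n + 1)).map ξ = ξ 0 :: (List.range n).map fun i => ξ (i + 1) := by
  simp [List.range_succ_eq_map, Function.comp_def]

/-- The intermediate states of an infinite execution are reached by the prefixes of its trace. -/
theorem reach_prefix {L : LTS.{u, v} Act} {p q : ℕ → L.State} {ξ : ℕ → Act}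
    (h : ∀ i, L.TauReach (p i) (q i) ∧ L.trans (q i) (some (ξ i)) (p (i + 1))) (i : ℕ) :
    L.Reach (p 0) ((List.range i).map ξ) (p i) := by
  induction i with
  | zero => exact Relation.ReflTransGen.refl
  | succ i ih =>
    rw [map_range_succ]
    exact reach_append.2 ⟨_, ih, (h i).1.append_reach (.of_trans (h i).2)⟩

theorem TauReach.append_infReach {L : LTS.{u, v} Act} {s t : L.State} {ξ : ℕ → Act}
    (h : L.TauReach s t) (h' : L.InfReach t ξ) : L.InfReach s ξ := by
  obtain ⟨p, q, rfl, hpq⟩ := h'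
  refine ⟨fun i => i.casesOn s fun i => p (i + 1), q, rfl, fun i => ?_⟩
  cases i with
  | zero => exact ⟨Relation.ReflTransGen.trans h (hpq 0).1, (hpq 0).2⟩
  | succ i => exact hpq (i + 1)

theorem InfReach.cons {L : LTS.{u, v} Act} {s t : L.State} {ξ : ℕ → Act}
    (h : L.trans s (some (ξ 0)) t) (h' : L.InfReach t fun i => ξ (i + 1)) : L.InfReach s ξ := by
  obtain ⟨p, q, rfl, hpq⟩ := h'
  refine ⟨fun i => i.casesOn s p, fun i => i.casesOn s q, rfl, fun i => ?_⟩
  cases i with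
  | zero => exact ⟨Relation.ReflTransGen.refl, h⟩
  | succ i => exact hpq i

theorem Reach.append_infReach {L : LTS.{u, v} Act} {n : ℕ} {s t : L.State} {ξ : ℕ → Act}
    (h : L.Reach s ((List.range n).map ξ) t) (h' : L.InfReach t fun i => ξ (n + i)) :
    L.InfReach s ξ := by
  induction n generalizing s ξ with
  | zero => exact TauReach.append_infReach h (by simpa using h')
  | succ n ih =>
    rw [map_range_succ_eq_cons] at h
    obtain ⟨u, u', h₁, h₂, h₃⟩ := h
    refine h₁.append_infReach (.cons h₂ (ih h₃ ?_))
    convert h' using 3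
    omega

/-- A state without divergence can become stable by `τ`-transitions. -/
theorem diverges_or_exists_stable (L : LTS.{u, v} Act) (s : L.State) :
    L.Diverges s ∨ ∃ t, L.TauReach s t ∧ ∀ t', ¬ L.trans t none t' := by
  by_contra! h
  obtain ⟨hd, h⟩ := h
  choose! f hf using h
  have hr : ∀ i, L.TauReach s (f^[i] s) := by
    intro i
    induction i with
    | zero => exact Relation.ReflTransGen.refl
    | succ i ih =>
      rw [Function.iterate_succ_apply']
      exact ih.tail (hf _ ih)
  refine hd ⟨fun i => f^[i] s, rfl, fun i => ?_⟩
  simp only [Function.iterate_succ_apply']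
  exact hf _ (hr i)

/-! ### Functional bisimulations -/

/-- `φ` is a functional bisimulation: the transitions of `φ s` in `L'` are exactly the images of
the transitions of `s` in `L`. Initial states and alphabets need not correspond. -/
def IsBisimMap {L L' : LTS.{u, v} Act} (φ : L.State → L'.State) : Prop :=
  ∀ s x t, L'.trans (φ s) x t ↔ ∃ s', t = φ s' ∧ L.trans s x s'

namespace IsBisimMap

variable {L L' : LTS.{u, v} Act} {φ : L.State → L'.State}

theorem trans_map (h : IsBisimMap φ) {s s' : L.State} {x : Option Act} (hs : L.trans s x s') :
    L'.trans (φ s) x (φ s') :=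
  (h s x _).2 ⟨s', rfl, hs⟩

theorem tauReach_map (h : IsBisimMap φ) {s s' : L.State} (hs : L.TauReach s s') :
    L'.TauReach (φ s) (φ s') :=
  hs.map φ fun _ _ => h.trans_map

theorem exists_tauReach (h : IsBisimMap φ) {s : L.State} {t : L'.State}
    (ht : L'.TauReach (φ s) t) : ∃ s', t = φ s' ∧ L.TauReach s s' := by
  induction ht with
  | refl => exact ⟨s, rfl, Relation.ReflTransGen.refl⟩
  | tail _ ht ih =>
    obtain ⟨u, rfl, hu⟩ := ih
    obtain ⟨u', rfl, hu'⟩ := (h _ _ _).1 ht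
    exact ⟨u', rfl, hu.tail hu'⟩

theorem reach_map (h : IsBisimMap φ) {s s' : L.State} {σ : List Act} (hs : L.Reach s σ s') :
    L'.Reach (φ s) σ (φ s') := by
  induction σ generalizing s with
  | nil => exact h.tauReach_map hs
  | cons a σ ih =>
    obtain ⟨t, t', h₁, h₂, h₃⟩ := hs
    exact ⟨φ t, φ t', h.tauReach_map h₁, h.trans_map h₂, ih h₃⟩

theorem exists_reach (h : IsBisimMap φ) {s : L.State} {t : L'.State} {σ : List Act}
    (ht : L'.Reach (φ s) σ t) : ∃ s', t = φ s' ∧ L.Reach s σ s' := by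
  induction σ generalizing s with
  | nil => exact h.exists_tauReach ht
  | cons a σ ih =>
    obtain ⟨u, u', h₁, h₂, h₃⟩ := ht
    obtain ⟨w, rfl, hw⟩ := h.exists_tauReach h₁
    obtain ⟨w', rfl, hw'⟩ := (h _ _ _).1 h₂
    obtain ⟨s', rfl, hs'⟩ := ih h₃
    exact ⟨s', rfl, w, w', hw, hw', hs'⟩

theorem diverges_iff (h : IsBisimMap φ) {s : L.State} : L'.Diverges (φ s) ↔ L.Diverges s := by
  constructor
  · rintro ⟨p, hp0, hp⟩
    have hr : ∀ i, L'.TauReach (φ s) (p i) := by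
      intro i
      induction i with
      | zero => rw [hp0]; exact Relation.ReflTransGen.refl
      | succ i ih => exact ih.tail (hp i)
    have hτ : ∀ t i, p i = φ t → ∃ t', p (i + 1) = φ t' ∧ L.trans t none t' :=
      fun t i e => (h _ _ _).1 (e ▸ hp i)
    choose! f hf using hτ
    refine ⟨fun i => i.rec s fun i t => f t i, rfl, fun i => ?_⟩
    have he : p i = φ (i.rec s fun i t => f t i) := by
      induction i with
      | zero => exact hp0
      | succ i ih => exact (hf _ _ ih).1
    exact (hf _ _ he).2
  · rintro ⟨p, rfl, hp⟩
    exact ⟨fun i => φ (p i), rfl, fun i => h.trans_map (hp i)⟩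

theorem infReach_iff (h : IsBisimMap φ) {s : L.State} {ξ : ℕ → Act} :
    L'.InfReach (φ s) ξ ↔ L.InfReach s ξ := by
  constructor
  · rintro ⟨p, q, hp0, hp⟩
    have hstep : ∀ t i, p i = φ t → ∃ u t', L.TauReach t u ∧ p (i + 1) = φ t' ∧
        L.trans u (some (ξ i)) t' := by
      intro t i e
      obtain ⟨u, hu, hu'⟩ := h.exists_tauReach (e ▸ (hp i).1)
      obtain ⟨t', ht, ht'⟩ := (h _ _ _).1 (hu ▸ (hp i).2)
      exact ⟨u, t', hu', ht, ht'⟩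
    choose! g f hf using hstep
    have he : ∀ i, p i = φ (i.rec s fun i t => f t i) := by
      intro i
      induction i with
      | zero => exact hp0
      | succ i ih => exact (hf _ _ ih).2.1
    exact ⟨fun i => i.rec s fun i t => f t i, fun i => g (i.rec s fun i t => f t i) i, rfl,
      fun i => ⟨(hf _ _ (he i)).1, (hf _ _ (he i)).2.2⟩⟩
  · rintro ⟨p, q, rfl, hp⟩
    exact ⟨fun i => φ (p i), fun i => φ (q i), rfl,
      fun i => ⟨h.tauReach_map (hp i).1, h.trans_map (hp i).2⟩⟩

theorem forall_not_trans_iff (h : IsBisimMap φ) {s : L.State} {x : Option Act} :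
    (∀ t, ¬ L'.trans (φ s) x t) ↔ ∀ s', ¬ L.trans s x s' :=
  ⟨fun H _ hs => H _ (h.trans_map hs), fun H t ht => by
    obtain ⟨s', -, hs⟩ := (h _ _ _).1 ht
    exact H s' hs⟩

theorem cffd (h : IsBisimMap φ) (hinit : φ L.init = L'.init) (halph : L.alph = L'.alph) :
    CFFD L L' := by
  refine ⟨halph, ?_, ?_, ?_⟩
  · ext ⟨σ, A⟩
    constructor
    · rintro ⟨hA, s, hs, hst⟩
      exact ⟨halph ▸ hA, φ s, hinit ▸ h.reach_map hs,
        fun x hx => h.forall_not_trans_iff.2 (hst x hx)⟩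
    · rintro ⟨hA, t, ht, hst⟩
      obtain ⟨s, rfl, hs⟩ := h.exists_reach (hinit.symm ▸ ht)
      exact ⟨halph.symm ▸ hA, s, hs, fun x hx => h.forall_not_trans_iff.1 (hst x hx)⟩
  · ext σ
    constructor
    · rintro ⟨s, hs, hd⟩
      exact ⟨φ s, hinit ▸ h.reach_map hs, h.diverges_iff.2 hd⟩
    · rintro ⟨t, ht, hd⟩
      obtain ⟨s, rfl, hs⟩ := h.exists_reach (hinit.symm ▸ ht)
      exact ⟨s, hs, h.diverges_iff.1 hd⟩
  · ext ξ
    exact (hinit ▸ h.infReach_iff).symm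

end IsBisimMap

theorem CFFD.symm {L L' : LTS.{u, v} Act} (h : CFFD L L') : CFFD L' L :=
  ⟨h.1.symm, h.2.1.symm, h.2.2.1.symm, h.2.2.2.symm⟩

theorem CFFD.trans {L L' L'' : LTS.{u, v} Act} (h : CFFD L L') (h' : CFFD L' L'') :
    CFFD L L'' :=
  ⟨h.1.trans h'.1, h.2.1.trans h'.2.1, h.2.2.1.trans h'.2.2.1, h.2.2.2.trans h'.2.2.2⟩

/-! ### Preservation of the alphabet -/

/-- The LTS with one state and one loop, which is labelled `a`. -/
def loop (a : Act) : LTS.{u, v} Act where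
  State := PUnit
  alph := {a}
  trans _ x _ := x = some a
  init := ⟨⟩
  trans_mem := by
    rintro _ _ _ h
    exact Option.some.inj h

theorem cffd_par_loop {L : LTS.{u, v} Act} {a : Act} (h : L.alph = {a}) :
    CFFD L (L.par (loop a)) := by
  refine IsBisimMap.cffd (φ := fun s => (s, ⟨⟩)) ?_ rfl (by simp [par, loop, h])
  rintro s x ⟨t, ⟨⟩⟩
  have hmem : ∀ b s s', L.trans s (some b) s' → b = a := by
    intro b s s' hb
    have := L.trans_mem _ _ _ hb
    rwa [h] at this
  cases x with
  | none => simp [par, loop]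
  | some b =>
    simp only [par, loop, h]
    constructor
    · rintro (⟨_, h', _⟩ | ⟨hb, h', _⟩ | ⟨_, h', _⟩)
      · exact ⟨t, rfl, h'⟩
      · exact (hb ⟨a, rfl, h'.symm⟩).elim
      · exact ⟨t, rfl, h'⟩
    · rintro ⟨s', e, h'⟩
      cases e
      have := hmem _ _ _ h'
      subst this
      exact Or.inr (Or.inr ⟨by simp, h', rfl⟩)

/-- If `L` has the empty alphabet, then `L` and `L || loop a` disagree on `Sf` or on `Div`: the
initial state of `L` diverges or leads to a stable state, and only `L || loop a` can perform `a`
before that. -/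
theorem not_sf_div_par_loop {L : LTS.{u, v} Act} (a : Act) (h : L.alph = ∅)
    (hSf : L.Sf = (L.par (loop a)).Sf) (hDiv : L.Div = (L.par (loop a)).Div) : False := by
  have hno : ∀ {s s'}, ¬ L.Reach s [a] s' := by
    rintro s s' ⟨t, t', -, ht, -⟩
    have := L.trans_mem _ _ _ ht
    simp [h] at this
  have hτ : ∀ {s s' : L.State}, L.trans s none s' →
      (L.par (loop a)).trans (s, ⟨⟩) none (s', ⟨⟩) := fun hs => Or.inl ⟨by simp, hs, rfl⟩
  have ha : ∀ s : L.State, (L.par (loop a)).trans (s, ⟨⟩) (some a) (s, ⟨⟩) := fun s =>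
    Or.inr (Or.inl ⟨by simp [h], rfl, rfl⟩)
  rcases L.diverges_or_exists_stable L.init with ⟨p, hp0, hp⟩ | ⟨t, ht, hst⟩
  · have : [a] ∈ (L.par (loop a)).Div :=
      ⟨(L.init, ⟨⟩), Reach.of_trans (ha _), fun i => (p i, ⟨⟩), by simp only [hp0]; rfl,
        fun i => hτ (hp i)⟩
    rw [← hDiv] at this
    obtain ⟨s, hs, -⟩ := this
    exact hno hs
  · have : ([a], (∅ : Set Act)) ∈ (L.par (loop a)).Sf := by
      refine ⟨by simp, (t, ⟨⟩), ?_, ?_⟩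
      · exact (Reach.of_trans (ha _)).trans_tauReach
          (ht.map (L' := L.par (loop a)) (fun s => (s, ⟨⟩)) fun _ _ => hτ)
      · rintro x hx ⟨s', ⟨⟩⟩
        obtain rfl : x = none := by simpa using hx
        simpa [par, loop] using hst s'
    rw [← hSf] at this
    obtain ⟨-, s, hs, -⟩ := this
    exact hno hs

variable {r : LTS.{u, v} Act → LTS.{u, v} Act → Prop}

/-- Hiding all actions but `a` turns a difference of the alphabets into the difference between the
alphabets `{a}` and `∅`, which the parallel composition with `loop a` makes observable. -/
theorem IsCongruence.alph_subset (hcongr : IsCongruence r)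
    (hCFFD : ∀ L L' : LTS.{u, v} Act, CFFD L L' → r L L') (hSf : Preserves r Sf)
    (hDiv : Preserves r Div) {L L' : LTS.{u, v} Act} (h : r L L') : L.alph ⊆ L'.alph := by
  intro a ha
  by_contra ha'
  have h₁ := hcongr.hide {a}ᶜ _ _ h
  have h₂ : r (L.hide {a}ᶜ) ((L.hide {a}ᶜ).par (loop a)) :=
    hCFFD _ _ (cffd_par_loop (by ext b; simp only [LTS.hide]; aesop))
  have h₃ : r (L'.hide {a}ᶜ) ((L'.hide {a}ᶜ).par (loop a)) :=
    hcongr.equivalence.trans (hcongr.equivalence.symm h₁)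
      (hcongr.equivalence.trans h₂ (hcongr.par_right _ _ _ h₁))
  exact not_sf_div_par_loop a (by ext b; simp only [LTS.hide]; aesop) (hSf _ _ h₃) (hDiv _ _ h₃)

theorem IsCongruence.alph_eq (hcongr : IsCongruence r)
    (hCFFD : ∀ L L' : LTS.{u, v} Act, CFFD L L' → r L L') (hSf : Preserves r Sf)
    (hDiv : Preserves r Div) {L L' : LTS.{u, v} Act} (h : r L L') : L.alph = L'.alph :=
  (hcongr.alph_subset hCFFD hSf hDiv h).antisymm
    (hcongr.alph_subset hCFFD hSf hDiv (hcongr.equivalence.symm h))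

/-! ### Following one infinite trace -/

/-- The LTS with alphabet `A` whose only maximal trace is `ξ`. -/
def follow (A : Set Act) (ξ : ℕ → Act) (h : ∀ i, ξ i ∈ A) : LTS.{u, v} Act where
  State := ULift ℕ
  alph := A
  trans i x j := x = some (ξ i.down) ∧ j.down = i.down + 1
  init := ⟨0⟩
  trans_mem := by
    rintro i a j ⟨e, -⟩
    cases e
    exact h _

theorem inf_par_follow_nonempty_iff {L : LTS.{u, v} Act} {ξ : ℕ → Act} (h : ∀ i, ξ i ∈ L.alph) :
    (L.par (follow L.alph ξ h)).Inf.Nonempty ↔ ξ ∈ L.Inf := by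
  constructor
  · rintro ⟨ζ, p, q, hp0, hp⟩
    have hvis : ∀ {s s' b}, (L.par (follow L.alph ξ h)).trans s (some b) s' →
        b = ξ s.2.down ∧ s'.2.down = s.2.down + 1 ∧ L.trans s.1 (some b) s'.1 := by
      rintro s s' b (⟨hb, h', _⟩ | ⟨hb, h', _⟩ | ⟨_, h', h''⟩)
      · exact (hb ⟨b, L.trans_mem _ _ _ h', rfl⟩).elim
      · exact (hb ⟨b, (follow L.alph ξ h).trans_mem _ _ _ h', rfl⟩).elim
      · exact ⟨Option.some.inj h''.1, h''.2, h'⟩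
    have hτ : ∀ {s s'}, (L.par (follow L.alph ξ h)).TauReach s s' →
        s'.2 = s.2 ∧ L.TauReach s.1 s'.1 := by
      intro s s' hs
      induction hs with
      | refl => exact ⟨rfl, Relation.ReflTransGen.refl⟩
      | tail _ hs ih =>
        rcases hs with ⟨-, hs, e⟩ | ⟨-, hs, e⟩ | ⟨hs, -⟩
        · exact ⟨e.trans ih.1, ih.2.tail hs⟩
        · cases hs.1
        · simp at hs
    have hidx : ∀ i, (p i).2.down = i := by
      intro i
      induction i with
      | zero => rw [hp0]; rfl
      | succ i ih => rw [(hvis (hp i).2).2.1, (hτ (hp i).1).1, ih]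
    refine ⟨fun i => (p i).1, fun i => (q i).1, by simp only [hp0]; rfl, fun i =>
      ⟨(hτ (hp i).1).2, ?_⟩⟩
    have hv := hvis (hp i).2
    rw [(hτ (hp i).1).1, hidx] at hv
    rw [← hv.1]
    exact hv.2.2
  · rintro ⟨p, q, hp0, hp⟩
    refine ⟨ξ, fun i => (p i, ⟨i⟩), fun i => (q i, ⟨i⟩), by simp only [hp0]; rfl, fun i => ⟨?_, ?_⟩⟩
    · exact (hp i).1.map (L' := L.par (follow L.alph ξ h)) (fun s => (s, ⟨i⟩))
        fun _ _ hs => Or.inl ⟨by simp, hs, rfl⟩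
    · exact Or.inr (Or.inr ⟨⟨ξ i, ⟨h i, h i⟩, rfl⟩, (hp i).2, rfl, rfl⟩)

theorem mem_alph_of_mem_inf {L : LTS.{u, v} Act} {ξ : ℕ → Act} (h : ξ ∈ L.Inf) (i : ℕ) :
    ξ i ∈ L.alph := by
  obtain ⟨p, q, -, hp⟩ := h
  exact L.trans_mem _ _ _ (hp i).2

/-! ### Adding infinite traces whose late prefixes are divergence traces -/

/-- The states that can be reached by the trace `σ`. -/
def after (L : LTS.{u, v} Act) (σ : List Act) : Set L.State :=
  {s | L.Reach L.init σ s}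

/-- The states that can be reached from `X` by the label `x`, up to `τ`-transitions if `x` is
visible. The label `τ` leaves `X` as it is, which suits the sets `after L σ`, as they are closed
under `τ`-transitions. -/
def succ (L : LTS.{u, v} Act) (X : Set L.State) : Option Act → Set L.State
  | none => X
  | some a => {t | ∃ s ∈ X, L.Reach s [a] t}

theorem succ_after (L : LTS.{u, v} Act) (σ : List Act) (a : Act) :
    L.succ (L.after σ) (some a) = L.after (σ ++ [a]) := by
  ext t
  exact reach_append.symm

/-- Some state in `X` diverges. -/
def HasDiv (L : LTS.{u, v} Act) (X : Set L.State) : Prop :=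
  ∃ s ∈ X, L.Diverges s

theorem HasDiv.mem_alph {L : LTS.{u, v} Act} {X : Set L.State} {a : Act}
    (h : L.HasDiv (L.succ X (some a))) : a ∈ L.alph := by
  obtain ⟨_, ⟨_, _, _, _, _, h, _⟩, _⟩ := h
  exact L.trans_mem _ _ _ h

/-- The infinite sequences almost all of whose finite prefixes are divergence traces. -/
def evDiv (L : LTS.{u, v} Act) : Set (ℕ → Act) :=
  {ξ | ∃ n : ℕ, ∀ i, n ≤ i → (List.range i).map ξ ∈ L.Div}

theorem inf_union_evDiv (L : LTS.{u, v} Act) : L.Inf ∪ L.evDiv = L.aenI ∪ L.evDiv := by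
  ext ξ
  simp only [aenI, evDiv, Set.mem_union, Set.mem_ofPred_eq]
  constructor
  · rintro (h | h)
    · by_cases h' : ∃ n : ℕ, ∀ i, n ≤ i → (List.range i).map ξ ∈ L.Div
      · exact Or.inr h'
      · push Not at h'
        exact Or.inl ⟨h, h'⟩
    · exact Or.inr h
  · rintro (h | h)
    · exact Or.inl h.1
    · exact Or.inr h

/-- The states of `ext L Y`: a copy `base s` of the states of `L`, a copy `pre s X` that also stores
the set `X` of all states of `L` that the trace performed so far can reach, and states `post X w`
where `L` has been replaced by the state `w` of `Y`. -/
inductive ExtState (S W : Type v) : Type v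
  | base (s : S)
  | pre (s : S) (X : Set S)
  | post (X : Set S) (w : W)

/-- The transitions of `ext L Y`. The states `pre s X` and `post X w` are unstable, and `post X w`
is entered only if `X` contains a divergent state, so that neither adds to `Sf` or `Div`. -/
inductive ExtTrans (L Y : LTS.{u, v} Act) :
    ExtState L.State Y.State → Option Act → ExtState L.State Y.State → Prop
  | base {s : L.State} {x : Option Act} {s' : L.State} :
      L.trans s x s' → ExtTrans L Y (.base s) x (.base s')
  | leave {s : L.State} {X : Set L.State} : ExtTrans L Y (.pre s X) none (.base s)
  | pre {s : L.State} {X : Set L.State} {x : Option Act} {s' : L.State} :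
      L.trans s x s' → ExtTrans L Y (.pre s X) x (.pre s' (L.succ X x))
  | enter {s : L.State} {X : Set L.State} {a : Act} : L.HasDiv (L.succ X (some a)) →
      ExtTrans L Y (.pre s X) (some a) (.post (L.succ X (some a)) Y.init)
  | idle {X : Set L.State} {w : Y.State} : ExtTrans L Y (.post X w) none (.post X w)
  | silent {X : Set L.State} {w w' : Y.State} : Y.trans w none w' →
      ExtTrans L Y (.post X w) none (.post X w')
  | post {X : Set L.State} {a c : Act} {w w' : Y.State} : Y.trans w (some c) w' →
      L.HasDiv (L.succ X (some a)) →
      ExtTrans L Y (.post X w) (some a) (.post (L.succ X (some a)) w')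

/-- The extension of `L` by infinite traces almost all of whose prefixes are divergence traces. It
behaves like `L` until it jumps to `Y`. From then on it performs any visible actions that keep the
trace in `Div L`, as many of them as `Y` performs. -/
def ext (L Y : LTS.{u, v} Act) : LTS.{u, v} Act where
  State := ExtState L.State Y.State
  alph := L.alph
  trans := ExtTrans L Y
  init := .pre L.init (L.after [])
  trans_mem := by
    intro s a s' h
    cases h with
    | base h => exact L.trans_mem _ _ _ h
    | pre h => exact L.trans_mem _ _ _ h
    | enter h => exact h.mem_alph
    | post _ h => exact h.mem_alph

variable {L Y : LTS.{u, v} Act}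

theorem isBisimMap_base : IsBisimMap (L := L) (L' := L.ext Y) ExtState.base := by
  intro s x t
  constructor
  · rintro ⟨⟩
    exact ⟨_, rfl, ‹_›⟩
  · rintro ⟨s', rfl, h⟩
    exact .base h

theorem ext_tauReach_base (s : L.State) (X : Set L.State) :
    (L.ext Y).TauReach (.pre s X) (.base s) :=
  Relation.ReflTransGen.single .leave

theorem ext_reach_pre {s s' : L.State} {ρ σ : List Act} (h : L.Reach s σ s') :
    (L.ext Y).Reach (.pre s (L.after ρ)) σ (.pre s' (L.after (ρ ++ σ))) := by
  have hτ : ∀ {s s' : L.State} {X : Set L.State}, L.TauReach s s' →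
      (L.ext Y).TauReach (.pre s X) (.pre s' X) := fun {s s' X} h =>
    h.map (L' := L.ext Y) (fun s => .pre s X) fun _ _ => ExtTrans.pre
  induction σ generalizing s ρ with
  | nil =>
    rw [List.append_nil]
    exact hτ h
  | cons a σ ih =>
    obtain ⟨t, t', h₁, h₂, h₃⟩ := h
    refine ⟨_, _, hτ h₁, .pre h₂, ?_⟩
    rw [succ_after]
    simpa using ih (ρ := ρ ++ [a]) h₃

/-- The property of the states of `ext L Y` that holds after the trace `σ`. -/
def ExtInv (L Y : LTS.{u, v} Act) (σ : List Act) : ExtState L.State Y.State → Prop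
  | .base s => L.Reach L.init σ s
  | .pre s X => L.Reach L.init σ s ∧ X = L.after σ
  | .post X _ => X = L.after σ ∧ σ ∈ L.Div

theorem extInv_of_reach {σ : List Act} {s : (L.ext Y).State}
    (h : (L.ext Y).Reach (L.ext Y).init σ s) : ExtInv L Y σ s := by
  refine Reach.invariant (P := ExtInv L Y) (ρ := []) ?_ ?_ h
    ⟨Relation.ReflTransGen.refl, rfl⟩
  · intro ρ s s' hs h
    cases h with
    | base h => exact hs.trans_tauReach (.single h)
    | leave => exact hs.1
    | pre h => exact ⟨hs.1.trans_tauReach (.single h), hs.2⟩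
    | idle => exact hs
    | silent => exact hs
  · intro ρ s a s' hs h
    cases h with
    | base h => exact reach_append.2 ⟨_, hs, .of_trans h⟩
    | pre h =>
      obtain ⟨hs, rfl⟩ := hs
      exact ⟨reach_append.2 ⟨_, hs, .of_trans h⟩, succ_after _ _ _⟩
    | enter h =>
      obtain ⟨-, rfl⟩ := hs
      rw [succ_after] at *
      exact ⟨rfl, h⟩
    | post _ h =>
      obtain ⟨rfl, -⟩ := hs
      rw [succ_after] at *
      exact ⟨rfl, h⟩

theorem sf_ext (L Y : LTS.{u, v} Act) : (L.ext Y).Sf = L.Sf := by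
  ext ⟨σ, A⟩
  constructor
  · rintro ⟨hA, s, hs, hst⟩
    have hinv := extInv_of_reach hs
    cases s with
    | base s =>
      exact ⟨hA, s, hinv, fun x hx => isBisimMap_base.forall_not_trans_iff.1 (hst x hx)⟩
    | pre s X => exact (hst none (by simp) _ .leave).elim
    | post X w => exact (hst none (by simp) _ .idle).elim
  · rintro ⟨hA, s, hs, hst⟩
    exact ⟨hA, .base s, (ext_tauReach_base _ _).append_reach (isBisimMap_base.reach_map hs),
      fun x hx => isBisimMap_base.forall_not_trans_iff.2 (hst x hx)⟩

theorem div_ext (L Y : LTS.{u, v} Act) : (L.ext Y).Div = L.Div := by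
  ext σ
  constructor
  · rintro ⟨s, hs, p, rfl, hp⟩
    have hinv : ∀ i, ExtInv L Y σ (p i) := by
      intro i
      refine extInv_of_reach (hs.trans_tauReach ?_)
      induction i with
      | zero => exact Relation.ReflTransGen.refl
      | succ i ih => exact ih.tail (hp i)
    by_cases h : ∀ i, ∃ s X, p i = .pre s X
    · choose s X h using h
      refine ⟨s 0, ?_, s, rfl, fun i => ?_⟩
      · have := hinv 0
        rw [h] at this
        exact this.1
      · have := hp i
        rw [h, h] at this
        generalize X (i + 1) = X' at this
        cases this
        assumption
    · push Not at h
      obtain ⟨i, h⟩ := h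
      have hi := hinv i
      rcases hpi : p i with s | ⟨s, X⟩ | ⟨X, w⟩
      · rw [hpi] at hi
        exact ⟨s, hi, isBisimMap_base.diverges_iff.1
          ⟨fun j => p (i + j), hpi, fun j => hp (i + j)⟩⟩
      · exact (h s X hpi).elim
      · rw [hpi] at hi
        exact hi.2
  · rintro ⟨s, hs, hd⟩
    exact ⟨.base s, (ext_tauReach_base _ _).append_reach (isBisimMap_base.reach_map hs),
      isBisimMap_base.diverges_iff.2 hd⟩

/-- The state of `L` that a state of `ext L Y` stands for, if any. -/
def ExtState.outer? {S W : Type v} : ExtState S W → Option S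
  | .base s => some s
  | .pre s _ => some s
  | .post _ _ => none

/-- The state of `Y` that a state of `ext L Y` stands for, if any. -/
def ExtState.inner? {S W : Type v} : ExtState S W → Option W
  | .base _ => none
  | .pre _ _ => none
  | .post _ w => some w

theorem inner?_eq_none_of_tauReach {s s' : (L.ext Y).State} (h : (L.ext Y).TauReach s s')
    (hs : s.inner? = none) : s'.inner? = none := by
  induction h with
  | refl => exact hs
  | tail _ h ih => cases h <;> first | rfl | cases ih

theorem exists_outer?_of_tauReach {s s' : (L.ext Y).State} (h : (L.ext Y).TauReach s s')
    {t' : L.State} (ht' : s'.outer? = some t') : ∃ t, s.outer? = some t ∧ L.TauReach t t' := by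
  induction h generalizing t' with
  | refl => exact ⟨t', ht', Relation.ReflTransGen.refl⟩
  | tail _ h ih =>
    cases h with
    | base h =>
      cases ht'
      obtain ⟨t, ht, hr⟩ := ih rfl
      exact ⟨t, ht, hr.tail h⟩
    | leave => exact ih ht'
    | pre h =>
      cases ht'
      obtain ⟨t, ht, hr⟩ := ih rfl
      exact ⟨t, ht, hr.tail h⟩
    | idle => cases ht'
    | silent => cases ht'

theorem exists_inner?_of_tauReach {s s' : (L.ext Y).State} (h : (L.ext Y).TauReach s s')
    {w : Y.State} (hw : s.inner? = some w) : ∃ w', s'.inner? = some w' ∧ Y.TauReach w w' := by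
  induction h with
  | refl => exact ⟨w, hw, Relation.ReflTransGen.refl⟩
  | tail _ h ih =>
    obtain ⟨w', hw', hr⟩ := ih
    cases h with
    | base => cases hw'
    | leave => cases hw'
    | pre => cases hw'
    | idle => exact ⟨w', hw', hr⟩
    | silent h =>
      cases hw'
      exact ⟨_, rfl, hr.tail h⟩

theorem inf_subset_inf_ext (L Y : LTS.{u, v} Act) : L.Inf ⊆ (L.ext Y).Inf := fun _ h =>
  (ext_tauReach_base _ _).append_infReach (isBisimMap_base.infReach_iff.2 h)

theorem evDiv_subset_inf_ext (L : LTS.{u, v} Act) (hY : Y.Inf.Nonempty) :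
    L.evDiv ⊆ (L.ext Y).Inf := by
  rintro ξ ⟨n, hn⟩
  obtain ⟨ζ, P, Q, hP0, hP⟩ := hY
  obtain ⟨s, hs, -⟩ := hn n le_rfl
  have hstep : ∀ i, n ≤ i → L.HasDiv (L.succ (L.after ((List.range i).map ξ)) (some (ξ i))) := by
    intro i hi
    rw [succ_after, ← map_range_succ]
    exact hn _ (by omega)
  refine Reach.append_infReach (ext_reach_pre hs) (.cons (.enter (hstep n le_rfl)) ?_)
  rw [List.nil_append, succ_after]
  refine ⟨fun i => .post (L.after ((List.range (n + 1 + i)).map ξ)) (P i),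
    fun i => .post (L.after ((List.range (n + 1 + i)).map ξ)) (Q i), ?_, fun i => ⟨?_, ?_⟩⟩
  · simp only [hP0, map_range_succ, Nat.add_zero]
    rfl
  · exact (hP i).1.map (L' := L.ext Y) (fun w => .post _ w) fun _ _ => ExtTrans.silent
  · have := ExtTrans.post (hP i).2 (hstep (n + 1 + i) (by omega))
    rw [succ_after, ← map_range_succ, show n + 1 + i = n + (i + 1) by omega] at this
    simp only [show ∀ j, n + 1 + j = n + (j + 1) by omega]
    exact this

theorem inf_ext_subset (L Y : LTS.{u, v} Act) :
    (L.ext Y).Inf ⊆ L.Inf ∪ {ξ | Y.Inf.Nonempty ∧ ξ ∈ L.evDiv} := by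
  rintro ξ ⟨p, q, hp0, hp⟩
  by_cases h : ∀ i, ∃ t, (p i).outer? = some t
  · left
    choose P hP using h
    have hstep : ∀ i, ∃ t, L.TauReach (P i) t ∧ L.trans t (some (ξ i)) (P (i + 1)) := by
      intro i
      have ht : ∃ t, (q i).outer? = some t ∧ L.trans t (some (ξ i)) (P (i + 1)) := by
        have h₁ := (hp i).2
        have h₂ := hP (i + 1)
        generalize q i = s, p (i + 1) = s' at h₁ h₂
        cases h₁ with
        | base h => cases h₂; exact ⟨_, rfl, h⟩
        | pre h => cases h₂; exact ⟨_, rfl, h⟩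
        | enter => cases h₂
        | post => cases h₂
      obtain ⟨t, ht, htr⟩ := ht
      obtain ⟨t₀, ht₀, hr⟩ := exists_outer?_of_tauReach (hp i).1 ht
      rw [hP, Option.some.injEq] at ht₀
      exact ⟨t, ht₀ ▸ hr, htr⟩
    choose Q hQ using hstep
    refine ⟨P, Q, ?_, hQ⟩
    have := hP 0
    rw [hp0] at this
    exact (Option.some.inj this).symm
  · right
    push Not at h
    have hex : ∃ k, ∃ w, (p k).inner? = some w := by
      obtain ⟨k, hk⟩ := h
      refine ⟨k, ?_⟩
      rcases hpk : p k with s | ⟨s, X⟩ | ⟨X, w⟩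
      · exact (hk s (by rw [hpk]; rfl)).elim
      · exact (hk s (by rw [hpk]; rfl)).elim
      · exact ⟨w, rfl⟩
    -- The first visible transition into a state of `Y` is a jump, hence leads to `Y.init`.
    obtain ⟨k, hk⟩ : ∃ k, (p k).inner? = some Y.init := by
      classical
      have hmin := fun m => Nat.find_min hex (m := m)
      obtain ⟨w, hw⟩ := Nat.find_spec hex
      rcases hm : Nat.find hex with _ | m
      · rw [hm, hp0] at hw
        cases hw
      · refine ⟨m + 1, ?_⟩
        rw [hm] at hw
        have hq : (q m).inner? = none := by
          refine inner?_eq_none_of_tauReach (hp m).1 ?_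
          exact Option.eq_none_iff_forall_not_mem.2 fun w' hw' => hmin m (by omega) ⟨w', hw'⟩
        have h₁ := (hp m).2
        generalize q m = s, p (m + 1) = s' at h₁ hw hq
        cases h₁ with
        | base => cases hw
        | pre => cases hw
        | enter => rfl
        | post => cases hq
    have hstep : ∀ i w, (p i).inner? = some w →
        ∃ u w' c, Y.TauReach w u ∧ Y.trans u (some c) w' ∧ (p (i + 1)).inner? = some w' := by
      intro i w hw
      obtain ⟨u, hu, hr⟩ := exists_inner?_of_tauReach (hp i).1 hw
      have h₁ := (hp i).2
      generalize q i = s, p (i + 1) = s' at h₁ hu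
      cases h₁ with
      | base => cases hu
      | pre => cases hu
      | enter => cases hu
      | post h => cases hu; exact ⟨_, _, _, hr, h, rfl⟩
    have hall : ∀ i, ∃ w, (p (k + i)).inner? = some w := by
      intro i
      induction i with
      | zero => exact ⟨_, hk⟩
      | succ i ih =>
        obtain ⟨w, hw⟩ := ih
        obtain ⟨_, w', _, _, _, h⟩ := hstep _ _ hw
        exact ⟨w', h⟩
    choose W hW using hall
    constructor
    · choose u w' c h₁ h₂ h₃ using fun i => hstep _ _ (hW i)
      refine ⟨c, W, u, ?_, fun i => ⟨h₁ i, ?_⟩⟩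
      · have := hW 0
        rw [Nat.add_zero, hk] at this
        exact (Option.some.inj this).symm
      · have : w' i = W (i + 1) := Option.some.inj ((h₃ i).symm.trans (hW (i + 1)))
        exact this ▸ h₂ i
    · refine ⟨k, fun i hi => ?_⟩
      obtain ⟨j, rfl⟩ := Nat.exists_eq_add_of_le hi
      have hr := reach_prefix hp (k + j)
      rw [hp0] at hr
      have hinv := extInv_of_reach hr
      have hj := hW j
      generalize p (k + j) = s at hinv hj
      cases s with
      | base => cases hj
      | pre => cases hj
      | post => exact hinv.2

theorem cffd_ext (L : LTS.{u, v} Act) (hY : ¬ Y.Inf.Nonempty) : CFFD L (L.ext Y) := by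
  refine ⟨rfl, (sf_ext L Y).symm, (div_ext L Y).symm, ?_⟩
  refine (inf_subset_inf_ext L Y).antisymm fun ξ h => ?_
  rcases inf_ext_subset L Y h with h | h
  · exact h
  · exact (hY h.1).elim

theorem inf_ext (L : LTS.{u, v} Act) (hY : Y.Inf.Nonempty) :
    (L.ext Y).Inf = L.aenI ∪ L.evDiv := by
  rw [← inf_union_evDiv]
  refine Set.Subset.antisymm (fun ξ h => ?_)
    (Set.union_subset (inf_subset_inf_ext L Y) (evDiv_subset_inf_ext L hY))
  exact (inf_ext_subset L Y h).imp_right And.right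

/-- If `Y` has an infinite trace, then `ext L Y` has all infinite traces that are compatible with
`Div L`, so that it no longer shows how `L` and `L'` differ outside `aenI`. -/
theorem SfDivAenIEquiv.cffd_ext {L L' : LTS.{u, v} Act} (h : SfDivAenIEquiv L L')
    (hY : Y.Inf.Nonempty) : CFFD (L.ext Y) (L'.ext Y) := by
  obtain ⟨h₁, h₂, h₃, h₄⟩ := h
  refine ⟨h₁, ?_, ?_, ?_⟩
  · rw [sf_ext, sf_ext, h₂]
  · rw [div_ext, div_ext, h₃]
  · rw [inf_ext L hY, inf_ext L' hY, h₄, evDiv, evDiv, h₃]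

end LTS

/-! ### The extension as a context -/

namespace LTS

variable {Act : Type u}

/-- The states of `controller e L`. -/
inductive CtlState (S : Type v) : Type v
  | base (s : S)
  | pre (s : S) (X : Set S)
  | post (X : Set S)

/-- The transitions of `controller e L`, those of `ext L Y` with the part of `Y` left out. Visible
actions that take part in `Y` are labelled by the second copy of `Act`, all others by the first. -/
inductive CtlTrans (e : Act ⊕ Act ≃ Act) (L : LTS.{u, v} Act) :
    CtlState L.State → Option Act → CtlState L.State → Prop
  | base {s : L.State} {x : Option Act} {s' : L.State} : L.trans s x s' →
      CtlTrans e L (.base s) (x.map fun a => e (.inl a)) (.base s')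
  | leave {s : L.State} {X : Set L.State} : CtlTrans e L (.pre s X) none (.base s)
  | pre {s : L.State} {X : Set L.State} {x : Option Act} {s' : L.State} : L.trans s x s' →
      CtlTrans e L (.pre s X) (x.map fun a => e (.inl a)) (.pre s' (L.succ X x))
  | enter {s : L.State} {X : Set L.State} {a : Act} : L.HasDiv (L.succ X (some a)) →
      CtlTrans e L (.pre s X) (some (e (.inr a))) (.post (L.succ X (some a)))
  | idle {X : Set L.State} : CtlTrans e L (.post X) none (.post X)
  | post {X : Set L.State} {a : Act} : L.HasDiv (L.succ X (some a)) →
      CtlTrans e L (.post X) (some (e (.inr a))) (.post (L.succ X (some a)))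

/-- The part of `ext L Y` that depends on `L` only, over two disjoint copies of the actions. -/
def controller (e : Act ⊕ Act ≃ Act) (L : LTS.{u, v} Act) : LTS.{u, v} Act where
  State := CtlState L.State
  alph := {b | ∃ a ∈ L.alph, b = e (.inl a) ∨ b = e (.inr a)}
  trans := CtlTrans e L
  init := .pre L.init (L.after [])
  trans_mem := by
    intro s b s' h
    generalize hx : some b = x at h
    cases h with
    | base h =>
      obtain ⟨a, rfl, rfl⟩ := Option.map_eq_some_iff.1 hx.symm
      exact ⟨a, L.trans_mem _ _ _ h, Or.inl rfl⟩
    | leave => cases hx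
    | pre h =>
      obtain ⟨a, rfl, rfl⟩ := Option.map_eq_some_iff.1 hx.symm
      exact ⟨a, L.trans_mem _ _ _ h, Or.inl rfl⟩
    | enter h =>
      cases hx
      exact ⟨_, h.mem_alph, Or.inr rfl⟩
    | idle => cases hx
    | post h =>
      cases hx
      exact ⟨_, h.mem_alph, Or.inr rfl⟩

/-- Renames every action in `B` to every action in the second copy of `A`. -/
def blur (e : Act ⊕ Act ≃ Act) (A B : Set Act) : Set (Act × Act) :=
  {p | p.1 ∈ B ∧ ∃ c ∈ A, p.2 = e (.inr c)}

/-- Merges the two copies of the actions. -/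
def merge (e : Act ⊕ Act ≃ Act) : Set (Act × Act) :=
  {p | p.2 = Sum.elim id id (e.symm p.1)}

/-- `ext L Y` as a context built from the operators, where `A` is the alphabet of `L`, `B` is that
of `Y` and `b ∈ B`. The prefix `b` keeps `Y`, which may diverge, inactive until the jump. -/
def context (e : Act ⊕ Act ≃ Act) (A B : Set Act) (b : Act) (M Y : LTS.{u, v} Act) :
    LTS.{u, v} Act :=
  (M.par ((Y.prefixing b).rename (blur e A B))).rename (merge e)

theorem IsCongruence.context {r : LTS.{u, v} Act → LTS.{u, v} Act → Prop}
    (hcongr : IsCongruence r) (e : Act ⊕ Act ≃ Act) (A B : Set Act) (b : Act)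
    (M : LTS.{u, v} Act) {Y Y' : LTS.{u, v} Act} (h : r Y Y') :
    r (context e A B b M Y) (context e A B b M Y') :=
  hcongr.rename _ _ _ (hcongr.par_left _ _ _ (hcongr.rename _ _ _ (hcongr.prefixing _ _ _ h)))

theorem renames_merge_iff {e : Act ⊕ Act ≃ Act} {a b : Act} :
    Renames (merge e) a b ↔ b = Sum.elim id id (e.symm a) := by
  constructor
  · rintro (h | ⟨-, h⟩)
    · exact h
    · exact (h ⟨Sum.elim id id (e.symm a), rfl⟩).elim
  · exact Or.inl

theorem renamesLabel_merge_iff {e : Act ⊕ Act ≃ Act} {x y : Option Act} :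
    RenamesLabel (merge e) x y ↔ y = x.map fun a => Sum.elim id id (e.symm a) := by
  cases x <;> cases y <;> simp [RenamesLabel, renames_merge_iff]

theorem renames_blur_iff {e : Act ⊕ Act ≃ Act} {A B : Set Act} (hA : A.Nonempty) {a b : Act}
    (ha : a ∈ B) : Renames (blur e A B) a b ↔ ∃ c ∈ A, b = e (.inr c) := by
  obtain ⟨c₀, hc₀⟩ := hA
  constructor
  · rintro (h | ⟨-, h⟩)
    · exact h.2
    · exact (h ⟨e (.inr c₀), ha, c₀, hc₀, rfl⟩).elim
  · exact fun h => Or.inl ⟨ha, h⟩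

variable {e : Act ⊕ Act ≃ Act} {L Y : LTS.{u, v} Act} {b : Act}

theorem alph_blur (hA : L.alph.Nonempty) (hb : b ∈ Y.alph) :
    ((Y.prefixing b).rename (blur e L.alph Y.alph)).alph = {d | ∃ c ∈ L.alph, d = e (.inr c)} := by
  ext d
  constructor
  · rintro ⟨a, ha, h⟩
    have : a ∈ Y.alph := by
      rcases ha with ha | rfl
      · exact ha
      · exact hb
    exact (renames_blur_iff hA this).1 h
  · exact fun h => ⟨b, Or.inr rfl, (renames_blur_iff hA hb).2 h⟩

theorem alph_context (hA : L.alph.Nonempty) (hb : b ∈ Y.alph) :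
    (context e L.alph Y.alph b (controller e L) Y).alph = L.alph := by
  ext a
  constructor
  · rintro ⟨d, hd, h⟩
    rw [renames_merge_iff] at h
    subst h
    rcases hd with hd | hd
    · obtain ⟨c, hc, rfl | rfl⟩ := hd <;> simpa using hc
    · rw [alph_blur hA hb] at hd
      obtain ⟨c, hc, rfl⟩ := hd
      simpa using hc
  · exact fun ha => ⟨e (.inl a), Or.inl ⟨a, ha, Or.inl rfl⟩, renames_merge_iff.2 (by simp)⟩

/-- The states of the context that correspond to those of `ext L Y`. -/
def ExtState.toContext {S W : Type v} : ExtState S W → CtlState S × Option W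
  | .base s => (.base s, none)
  | .pre s X => (.pre s X, none)
  | .post X w => (.post X, some w)

theorem isBisimMap_toContext (hA : L.alph.Nonempty) (hb : b ∈ Y.alph) :
    IsBisimMap (L := L.ext Y) (L' := context e L.alph Y.alph b (controller e L) Y)
      ExtState.toContext := by
  have halph := alph_blur (e := e) hA hb
  have hinl : ∀ x : Option Act, (x.map fun a => e (.inl a)) ∉
      some '' ((Y.prefixing b).rename (blur e L.alph Y.alph)).alph := by
    rintro x ⟨d, hd, h⟩
    rw [halph] at hd
    obtain ⟨c, -, rfl⟩ := hd
    obtain ⟨a, -, h⟩ := Option.map_eq_some_iff.1 h.symm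
    simp at h
  have hinr : ∀ a ∈ L.alph, some (e (.inr a)) ∈
      some '' ((Y.prefixing b).rename (blur e L.alph Y.alph)).alph := fun a ha => by
    rw [halph]
    exact ⟨_, ⟨a, ha, rfl⟩, rfl⟩
  have hinr' : ∀ a ∈ L.alph, some (e (.inr a)) ∈ some '' ((controller e L).alph ∩
      ((Y.prefixing b).rename (blur e L.alph Y.alph)).alph) := fun a ha => by
    rw [halph]
    exact ⟨_, ⟨⟨a, ha, Or.inr rfl⟩, a, ha, rfl⟩, rfl⟩
  intro s y t
  constructor
  · rintro ⟨x, hx, hy⟩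
    rw [renamesLabel_merge_iff] at hy
    subst hy
    rcases t with ⟨m, h⟩
    rcases hx with ⟨hx, hm, hh⟩ | ⟨hx, hh, hm⟩ | ⟨hx, hm, hh⟩
    · -- A transition of the controller alone.
      cases s with
      | base s =>
        cases hh
        cases hm with
        | base hm =>
          refine ⟨.base _, rfl, ?_⟩
          simpa [Function.comp_def] using! ExtTrans.base hm
      | pre s X =>
        cases hh
        cases hm with
        | leave => exact ⟨.base _, rfl, .leave⟩
        | pre hm =>
          refine ⟨.pre _ _, rfl, ?_⟩
          simpa [Function.comp_def] using! ExtTrans.pre hm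
        | enter hm => exact (hx (hinr _ hm.mem_alph)).elim
      | post X w =>
        cases hh
        cases hm with
        | idle => exact ⟨.post _ _, rfl, .idle⟩
        | post hm => exact (hx (hinr _ hm.mem_alph)).elim
    · -- A transition of the context of `Y` alone, which is invisible.
      obtain ⟨z, hz, hzx⟩ := hh
      cases x with
      | some d =>
        have hd := LTS.trans_mem _ _ _ _ (show
          ((Y.prefixing b).rename (blur e L.alph Y.alph)).trans _ (some d) _ from ⟨z, hz, hzx⟩)
        rw [halph] at hd
        obtain ⟨c, hc, rfl⟩ := hd
        exact (hx ⟨_, ⟨c, hc, Or.inr rfl⟩, rfl⟩).elim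
      | none =>
        cases z with
        | some _ => exact hzx.elim
        | none =>
          cases s with
          | base s => cases hz
          | pre s X => cases hz
          | post X w =>
            cases hm
            cases hz with
            | step _ _ w' hz => exact ⟨.post _ _, rfl, .silent hz⟩
    · -- A joint transition.
      obtain ⟨d, ⟨-, hd⟩, rfl⟩ := hx
      rw [halph] at hd
      obtain ⟨c, hc, rfl⟩ := hd
      obtain ⟨z, hz, hzx⟩ := hh
      have hno : ∀ z : Option Act, (z.map fun a => e (.inl a)) ≠ some (e (.inr c)) := by
        intro z h
        obtain ⟨a, -, h⟩ := Option.map_eq_some_iff.1 h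
        simp at h
      generalize hx : some (e (.inr c)) = x at hm
      cases s with
      | base s =>
        cases hm with
        | base hm => exact (hno _ hx.symm).elim
      | pre s X =>
        cases hm with
        | leave => cases hx
        | pre hm => exact (hno _ hx.symm).elim
        | enter hm =>
          simp only [Option.some.injEq, EmbeddingLike.apply_eq_iff_eq, Sum.inr.injEq] at hx
          subst hx
          cases hz with
          | start =>
            refine ⟨.post _ _, rfl, ?_⟩
            simpa using! ExtTrans.enter hm
      | post X w =>
        cases hm with
        | idle => cases hx
        | post hm =>
          simp only [Option.some.injEq, EmbeddingLike.apply_eq_iff_eq, Sum.inr.injEq] at hx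
          subst hx
          cases hz with
          | step _ _ w' hz =>
            cases z with
            | none => exact hzx.elim
            | some a =>
              refine ⟨.post _ _, rfl, ?_⟩
              simpa using! ExtTrans.post hz hm
  · rintro ⟨s', rfl, h⟩
    cases h with
    | @base s _ s' h =>
      refine ⟨y.map fun a => e (.inl a), Or.inl ⟨hinl _, .base h, rfl⟩, ?_⟩
      simp [renamesLabel_merge_iff, Function.comp_def]
    | leave => exact ⟨none, Or.inl ⟨by simp, .leave, rfl⟩, trivial⟩
    | @pre s X _ s' h =>
      refine ⟨y.map fun a => e (.inl a), Or.inl ⟨hinl _, .pre h, rfl⟩, ?_⟩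
      simp [renamesLabel_merge_iff, Function.comp_def]
    | @enter s X a h =>
      refine ⟨some (e (.inr a)), Or.inr (Or.inr ⟨hinr' _ h.mem_alph, .enter h, some b, .start,
        (renames_blur_iff hA hb).2 ⟨a, h.mem_alph, rfl⟩⟩), ?_⟩
      simp [renamesLabel_merge_iff]
    | idle => exact ⟨none, Or.inl ⟨by simp, .idle, rfl⟩, trivial⟩
    | silent h =>
      exact ⟨none, Or.inr (Or.inl ⟨by simp, ⟨none, .step _ _ _ h, trivial⟩, rfl⟩), trivial⟩
    | @post X a c w w' hw h =>
      refine ⟨some (e (.inr a)), Or.inr (Or.inr ⟨hinr' _ h.mem_alph, .post h, some c,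
        .step _ _ _ hw,
        (renames_blur_iff hA (Y.trans_mem _ _ _ hw)).2 ⟨a, h.mem_alph, rfl⟩⟩), ?_⟩
      simp [renamesLabel_merge_iff]

theorem cffd_ext_context (hA : L.alph.Nonempty) (hb : b ∈ Y.alph) :
    CFFD (L.ext Y) (context e L.alph Y.alph b (controller e L) Y) :=
  (isBisimMap_toContext hA hb).cffd rfl (alph_context hA hb).symm

variable {r : LTS.{u, v} Act → LTS.{u, v} Act → Prop}

/-- A congruence weaker than CFFD-equivalence is preserved by `ext L`. -/
theorem IsCongruence.ext [Infinite Act] (hcongr : IsCongruence r)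
    (hCFFD : ∀ L L' : LTS.{u, v} Act, CFFD L L' → r L L') (hA : L.alph.Nonempty)
    {Y Y' : LTS.{u, v} Act} (halph : Y.alph = Y'.alph) (hY : Y.alph.Nonempty) (h : r Y Y') :
    r (L.ext Y) (L.ext Y') := by
  obtain ⟨b, hb⟩ := hY
  obtain ⟨e⟩ : Nonempty (Act ⊕ Act ≃ Act) := by
    rw [← Cardinal.eq, Cardinal.mk_sum, Cardinal.lift_id,
      Cardinal.add_eq_self (Cardinal.aleph0_le_mk Act)]
  have h₁ := hCFFD _ _ (cffd_ext_context (e := e) hA hb)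
  have h₂ := hCFFD _ _ (cffd_ext_context (e := e) hA (halph ▸ hb))
  rw [← halph] at h₂
  exact hcongr.equivalence.trans h₁ (hcongr.equivalence.trans
    (hcongr.context e L.alph Y.alph b (controller e L) h) (hcongr.equivalence.symm h₂))

/-- Once the congruence relates an LTS that has an infinite trace to one that has none, it no longer
distinguishes LTSs that agree on the alphabet, `Sf`, `Div` and `aenI`. -/
theorem IsCongruence.of_sfDivAenIEquiv [Infinite Act] (hcongr : IsCongruence r)
    (hCFFD : ∀ L L' : LTS.{u, v} Act, CFFD L L' → r L L') {Y Y' : LTS.{u, v} Act}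
    (halph : Y.alph = Y'.alph) (h : r Y Y') (hY : Y.Inf.Nonempty) (hY' : ¬ Y'.Inf.Nonempty)
    {L L' : LTS.{u, v} Act} (hL : SfDivAenIEquiv L L') : r L L' := by
  have hYalph : Y.alph.Nonempty := by
    obtain ⟨ξ, hξ⟩ := hY
    exact ⟨ξ 0, mem_alph_of_mem_inf hξ 0⟩
  have heq := hcongr.equivalence
  by_cases hA : L.alph.Nonempty
  · have key : ∀ K : LTS.{u, v} Act, K.alph.Nonempty → r K (K.ext Y) := fun K hK =>
      heq.trans (hCFFD _ _ (LTS.cffd_ext K hY')) (heq.symm (hcongr.ext hCFFD hK halph hYalph h))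
    exact heq.trans (key L hA) (heq.trans (hCFFD _ _ (hL.cffd_ext hY))
      (heq.symm (key L' (hL.1 ▸ hA))))
  · -- Over the empty alphabet there are no infinite traces.
    have hinf : ∀ K : LTS.{u, v} Act, ¬ K.alph.Nonempty → K.Inf = ∅ := fun K hK =>
      Set.eq_empty_of_forall_notMem fun ξ hξ => hK ⟨ξ 0, mem_alph_of_mem_inf hξ 0⟩
    exact hCFFD _ _ ⟨hL.1, hL.2.1, hL.2.2.1, by rw [hinf L hA, hinf L' (hL.1 ▸ hA)]⟩

end LTS

theorem mainTheorem9 {Act : Type u} [Infinite Act]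
    (r : LTS.{u, v} Act → LTS.{u, v} Act → Prop)
    (hcongr : LTS.IsCongruence r)
    (hCFFD : ∀ L L' : LTS.{u, v} Act, LTS.CFFD L L' → r L L')
    (hSf : LTS.Preserves r LTS.Sf)
    (hDiv : LTS.Preserves r LTS.Div)
    (haenI : LTS.Preserves r LTS.aenI)
    (hInf : ¬ LTS.Preserves r LTS.Inf) :
    ∀ L L' : LTS.{u, v} Act, r L L' ↔ LTS.SfDivAenIEquiv L L' := by
  intro L L'
  refine ⟨fun h => ⟨hcongr.alph_eq hCFFD hSf hDiv h, hSf _ _ h, hDiv _ _ h, haenI _ _ h⟩,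
    fun hL => ?_⟩
  obtain ⟨L₁, L₂, ξ, h, h₁, h₂⟩ : ∃ L₁ L₂ ξ, r L₁ L₂ ∧ ξ ∈ L₁.Inf ∧ ξ ∉ L₂.Inf := by
    by_contra! H
    exact hInf fun L₁ L₂ h => Set.Subset.antisymm (fun ξ => H L₁ L₂ ξ h)
      fun ξ => H L₂ L₁ ξ (hcongr.equivalence.symm h)
  have halph := hcongr.alph_eq hCFFD hSf hDiv h
  have hξ := LTS.mem_alph_of_mem_inf h₁
  refine hcongr.of_sfDivAenIEquiv hCFFD ?_ (hcongr.par_right _ _ (LTS.follow L₁.alph ξ hξ) h)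
    ((LTS.inf_par_follow_nonempty_iff hξ).2 h₁) ?_ hL
  · simp only [LTS.par, halph]
  · have key := LTS.inf_par_follow_nonempty_iff (L := L₂) (ξ := ξ) (halph ▸ hξ)
    simp only [← halph] at key
    exact fun hn => h₂ (key.1 hn)
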